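/- Let $\Gamma=(V,E)$ be a finite metric graph with at least one edge, i.e. a finite graph (not necessarily connected, loops and multiple edges allowed) in which every edge $e\in E$ is identified with an interval $[0,\ell_e]$ of length $\ell_e\in(0,\infty)$, the endpoints of the intervals being glued at the vertices. Let $L(\Gamma)=\sum_{e\in E}\ell_e$ be its total length and $|E|$ its number of edges. Consider the Laplacian $\Delta f=-f''$ with Dirichlet conditions at all vertices, i.e. the eigenvalue problem $$-f_e''=\lambda f_e \ \text{ on every edge } e\in E,\qquad f \text{ continuous on } \Gamma,\qquad f(v)=0 \ \text{ for all } v\in V,$$ for real functions $f$ on $\Gamma$ with $f_e\in W^{2,2}(0,\ell_e)$ for all $e\in E$. Then the eigenvalues of this problem have finite multiplicity and, repeated according to multiplicity, form a sequence $\lambda_1^D(\Delta)\le\lambda_2^D(\Delta)\le\cdots\nearrow\infty$, and $$\lambda_k^D(\Delta)\le\frac{\pi^2}{L(\Gamma)^2}\left(k-1+|E|\right)^2\qquad\text{for all } k\in\mathbb{N}=\{1,2,3,\dots\}.$$ -/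

import Mathlib

open MeasureTheory

open scoped ContDiff

/-- A metric graph with vertex set `V` and edge set `E`: every edge `e` is a closed interval
`[0, ℓ e]` of positive length, whose endpoint `0` belongs to the vertex `tail e` and whose
endpoint `ℓ e` belongs to the vertex `head e`. Loops and multiple edges are allowed, and
connectedness is not required. -/
structure MetricGraph (V E : Type*) where
  tail : E → V
  head : E → V
  len : E → ℝ
  len_pos : ∀ e, 0 < len e

namespace MetricGraph

variable {V E : Type*} (Γ : MetricGraph V E)

/-- The total length `L(Γ)`. -/
noncomputable def totalLength [Fintype E] : ℝ := ∑ e, Γ.len e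

/-- The disjoint union of the intervals `[0, ℓ e]`. -/
abbrev EdgePoint : Type _ := Σ e : E, Set.Icc (0 : ℝ) (Γ.len e)

/-- The point `p` of the disjoint union is an interval endpoint that belongs to the vertex `v`. -/
def IsEndpointAt (p : Γ.EdgePoint) (v : V) : Prop :=
  ((p.2 : ℝ) = 0 ∧ Γ.tail p.1 = v) ∨ ((p.2 : ℝ) = Γ.len p.1 ∧ Γ.head p.1 = v)

/-- Two interval endpoints are glued if they belong to the same vertex. -/
def Glued (p q : Γ.EdgePoint) : Prop := ∃ v, Γ.IsEndpointAt p v ∧ Γ.IsEndpointAt q v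

/-- The metric graph as a space: the disjoint union of the edges modulo the gluing. -/
def Point : Type _ := Quot Γ.Glued

/-- The quotient topology. -/
instance : TopologicalSpace Γ.Point := inferInstanceAs (TopologicalSpace (Quot Γ.Glued))

/-- The point of the graph represented by a point of an edge. -/
def pt (p : Γ.EdgePoint) : Γ.Point := Quot.mk _ p

/-- The restriction `f_e : [0, ℓ e] → ℝ` of a function on the graph to the edge `e`, as a function
on the real line. Only its values on `[0, ℓ e]` matter; outside, it is extended by constants. -/
noncomputable def onEdge (f : Γ.Point → ℝ) (e : E) (x : ℝ) : ℝ :=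
  f (Γ.pt ⟨e, Set.projIcc 0 (Γ.len e) (Γ.len_pos e).le x⟩)

/-- `u` and `v` lie in `L²(0, ℓ)` and `v` is the weak derivative of `u` on `(0, ℓ)`.
So `u ∈ W^{1,2}(0, ℓ)` iff such a `v` exists. -/
def HasWeakDerivL2 (ℓ : ℝ) (u v : ℝ → ℝ) : Prop :=
  MemLp u 2 (volume.restrict (Set.Ioo 0 ℓ)) ∧ MemLp v 2 (volume.restrict (Set.Ioo 0 ℓ)) ∧
  ∀ φ : ℝ → ℝ, ContDiff ℝ ∞ φ → HasCompactSupport φ → tsupport φ ⊆ Set.Ioo 0 ℓ →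
    ∫ x in Set.Ioo 0 ℓ, u x * deriv φ x = - ∫ x in Set.Ioo 0 ℓ, v x * φ x

/-- `f` lies in `W^{2,2}(e)` on every edge `e`, and `Δ f = - f'' = h` almost everywhere
on every edge (`Δ` is the positive Laplacian). -/
def HasLaplacian (f h : Γ.Point → ℝ) : Prop :=
  ∀ e, ∃ g : ℝ → ℝ, HasWeakDerivL2 (Γ.len e) (Γ.onEdge f e) g ∧
    HasWeakDerivL2 (Γ.len e) g (fun x => - Γ.onEdge h e x)

/-- Dirichlet vertex conditions: `f(v) = 0` at every vertex. -/
def VanishesAtVertices (f : Γ.Point → ℝ) : Prop :=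
  ∀ (p : Γ.EdgePoint) (v : V), Γ.IsEndpointAt p v → f (Γ.pt p) = 0

/-- `f` is in the domain of the Dirichlet Laplacian (it is in `W^{2,2}` on every edge, continuous on
the graph and zero at all vertices) and solves `Δ f = μ f` on the edges. -/
def IsDirichletSolution (μ : ℝ) (f : Γ.Point → ℝ) : Prop :=
  Γ.HasLaplacian f (fun x => μ * f x) ∧ Continuous f ∧ Γ.VanishesAtVertices f

theorem HasWeakDerivL2.integrable_mul {ℓ : ℝ} {u φ : ℝ → ℝ}
    (hu : MemLp u 2 (volume.restrict (Set.Ioo 0 ℓ))) (hφ : Continuous φ)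
    (hc : HasCompactSupport φ) :
    Integrable (fun x => u x * φ x) (volume.restrict (Set.Ioo 0 ℓ)) :=
  hu.integrable_mul (q := 2) ((hφ.memLp_of_hasCompactSupport hc).restrict _)

theorem HasWeakDerivL2.add {ℓ : ℝ} {u v u' v' : ℝ → ℝ} (h : HasWeakDerivL2 ℓ u v)
    (h' : HasWeakDerivL2 ℓ u' v') :
    HasWeakDerivL2 ℓ (fun x => u x + u' x) (fun x => v x + v' x) := by
  refine ⟨h.1.add h'.1, h.2.1.add h'.2.1, fun φ hφ hc hs => ?_⟩
  have hd : Continuous (deriv φ) := hφ.continuous_deriv (by simp)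
  simp only [add_mul]
  rw [integral_add (integrable_mul h.1 hd hc.deriv) (integrable_mul h'.1 hd hc.deriv),
    integral_add (integrable_mul h.2.1 hφ.continuous hc)
      (integrable_mul h'.2.1 hφ.continuous hc),
    h.2.2 φ hφ hc hs, h'.2.2 φ hφ hc hs, neg_add]

theorem HasWeakDerivL2.const_mul {ℓ : ℝ} {u v : ℝ → ℝ} (c : ℝ) (h : HasWeakDerivL2 ℓ u v) :
    HasWeakDerivL2 ℓ (fun x => c * u x) (fun x => c * v x) := by
  refine ⟨h.1.const_mul c, h.2.1.const_mul c, fun φ hφ hc hs => ?_⟩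
  simp only [mul_assoc]
  rw [integral_const_mul, integral_const_mul, h.2.2 φ hφ hc hs, mul_neg]

theorem hasWeakDerivL2_zero (ℓ : ℝ) : HasWeakDerivL2 ℓ (fun _ => 0) (fun _ => 0) := by
  refine ⟨MemLp.zero, MemLp.zero, fun φ _ _ _ => by simp⟩

/-- The space of solutions `f` of the Dirichlet eigenvalue problem `Δ f = μ f`. It is nonzero iff
`μ` is a Dirichlet eigenvalue, and its dimension is the multiplicity of `μ`. -/
def dirichletEigenspace (μ : ℝ) : Submodule ℝ (Γ.Point → ℝ) where
  carrier := {f | Γ.IsDirichletSolution μ f}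
  zero_mem' := by
    refine ⟨fun e => ⟨fun _ => 0, ?_, ?_⟩, continuous_const, fun _ _ _ => rfl⟩
    · exact hasWeakDerivL2_zero _
    · simpa [onEdge] using hasWeakDerivL2_zero (Γ.len e)
  add_mem' := by
    rintro f f' ⟨hf, hc, hv⟩ ⟨hf', hc', hv'⟩
    refine ⟨fun e => ?_, hc.add hc', fun p v hp => by simp [hv p v hp, hv' p v hp]⟩
    obtain ⟨g, h1, h2⟩ := hf e
    obtain ⟨g', h1', h2'⟩ := hf' e
    refine ⟨_, h1.add h1', ?_⟩
    convert h2.add h2' using 2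
    simp only [onEdge, Pi.add_apply]
    ring
  smul_mem' := by
    rintro c f ⟨hf, hc, hv⟩
    refine ⟨fun e => ?_, hc.const_smul c, fun p v hp => by simp [hv p v hp]⟩
    obtain ⟨g, h1, h2⟩ := hf e
    refine ⟨_, h1.const_mul c, ?_⟩
    convert h2.const_mul c using 2
    simp only [onEdge, Pi.smul_apply, smul_eq_mul]
    ring

/-- `lam 1 ≤ lam 2 ≤ ⋯ ↗ ∞` is the sequence of all eigenvalues of the Laplacian with Dirichlet
vertex conditions, each repeated according to its (finite) multiplicity. -/
structure IsDirichletEigenvalueSequence (lam : ℕ+ → ℝ) : Prop where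
  monotone : Monotone lam
  tendsto : Filter.Tendsto lam Filter.atTop Filter.atTop
  finite_mult : ∀ μ : ℝ, FiniteDimensional ℝ (Γ.dirichletEigenspace μ)
  ncard_eq : ∀ μ : ℝ, {k | lam k = μ}.ncard = Module.finrank ℝ (Γ.dirichletEigenspace μ)

end MetricGraph

/-! Vanishing at all vertices decouples the edges, so the spectrum with multiplicity is the family
$(\pi n/\ell_e)^2$ indexed by pairs $(e,n)$ (`eq_zero_or_eq_sin`, `finrank_dirichletEigenspace`).
Exactly $\sum_e\lfloor \ell_e\kappa\rfloor$ pairs have value at most $(\pi\kappa)^2$, and this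
exceeds $L\kappa-|E|$. For $\kappa=(k-1+|E|)/L$ the count is greater than $k-1$, hence at least $k$
(`le_ncard_edgeEigenvalue_le`), and monotonicity gives the bound on $\lambda_k$ (`le_of_le_ncard`).
The analytic input is the regularity of weak solutions, obtained from du Bois-Reymond. -/

namespace MetricGraph

/-! ### Weak derivatives on an interval -/

/-- A test function on `(0, ℓ)` of mean zero is the derivative of a test function. -/
theorem exists_testFunction_deriv_eq {ℓ : ℝ} {ψ : ℝ → ℝ} (hψ : ContDiff ℝ ∞ ψ)
    (hc : HasCompactSupport ψ) (hs : tsupport ψ ⊆ Set.Ioo 0 ℓ) (h0 : ∫ x, ψ x = 0) :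
    ∃ φ : ℝ → ℝ, ContDiff ℝ ∞ φ ∧ HasCompactSupport φ ∧ tsupport φ ⊆ Set.Ioo 0 ℓ ∧
      deriv φ = ψ := by
  rcases (tsupport ψ).eq_empty_or_nonempty with he | hne
  · have : ψ = fun _ => 0 := by
      have := tsupport_eq_empty_iff.1 he
      exact this
    subst this
    exact ⟨fun _ => 0, hψ, hc, hs, by simp⟩
  obtain ⟨a, ha⟩ := hc.isCompact.exists_isLeast hne
  obtain ⟨b, hb⟩ := hc.isCompact.exists_isGreatest hne
  have hK : Function.support ψ ⊆ Set.Icc a b := fun x hx =>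
    ⟨ha.2 (subset_tsupport _ hx), hb.2 (subset_tsupport _ hx)⟩
  have ha0 := (hs ha.1).1
  have hbl := (hs hb.1).2
  have hd : ∀ x, HasDerivAt (fun x => ∫ t in (0 : ℝ)..x, ψ t) (ψ x) x := fun x =>
    hψ.continuous.integral_hasStrictDerivAt 0 x |>.hasDerivAt
  have hder : deriv (fun x => ∫ t in (0 : ℝ)..x, ψ t) = ψ := funext fun x => (hd x).deriv
  have hsub : Function.support (fun x => ∫ t in (0 : ℝ)..x, ψ t) ⊆ Set.Icc a b := by
    intro x hx
    by_contra hx'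
    apply hx
    rw [Set.mem_Icc, not_and_or, not_le, not_le] at hx'
    rcases hx' with h | h
    -- Since $0<a$ and $x<a$, the whole interval between $0$ and $x$ lies left of the support, also
    -- for negative $x$.
    · refine (intervalIntegral.integral_congr (g := fun _ => 0) fun t ht => ?_).trans (by simp)
      by_contra hne
      have h1 := (hK hne).1
      have h2 : t ≤ max 0 x := ht.2
      exact absurd (h1.trans h2) (not_le.2 (max_lt ha0 h))
    · change ∫ t in (0 : ℝ)..x, ψ t = 0
      rw [intervalIntegral.integral_eq_integral_of_support_subset, h0]
      exact fun t ht => ⟨ha0.trans_le (hK ht).1, (hK ht).2.trans h.le⟩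
  have hts : tsupport (fun x => ∫ t in (0 : ℝ)..x, ψ t) ⊆ Set.Icc a b :=
    closure_minimal hsub isClosed_Icc
  refine ⟨_, contDiff_infty_iff_deriv.2 ⟨fun x => (hd x).differentiableAt, by rw [hder]; exact hψ⟩,
    HasCompactSupport.of_support_subset_isCompact isCompact_Icc hsub, hts.trans ?_, hder⟩
  exact fun x hx => ⟨ha0.trans_le hx.1, hx.2.trans_lt hbl⟩

theorem setIntegral_Ioo_eq_integral_of_tsupport_subset {ℓ : ℝ} {φ : ℝ → ℝ}
    (hs : tsupport φ ⊆ Set.Ioo 0 ℓ) :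
    ∫ x in Set.Ioo 0 ℓ, φ x = ∫ x, φ x :=
  setIntegral_eq_integral_of_forall_compl_eq_zero fun _ hx =>
    image_eq_zero_of_notMem_tsupport fun h => hx (hs h)

/-- The lemma of du Bois-Reymond: a function with weak derivative zero is constant. -/
theorem HasWeakDerivL2.ae_eq_const {ℓ : ℝ} (hℓ : 0 < ℓ) {u : ℝ → ℝ}
    (h : HasWeakDerivL2 ℓ u fun _ => 0) :
    ∃ c : ℝ, ∀ᵐ x ∂(volume.restrict (Set.Ioo 0 ℓ)), u x = c := by
  obtain ⟨ρ, hρs, hρc, hρ, hρr, hρ1⟩ :=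
    exists_contDiff_tsupport_subset (n := ⊤) (Ioo_mem_nhds (half_pos hℓ) (half_lt_self hℓ))
  have hρpos : 0 < ∫ x, ρ x := by
    refine hρ.continuous.integral_pos_of_hasCompactSupport_nonneg_nonzero hρc
      (fun x => (hρr ⟨x, rfl⟩).1) (x := ℓ / 2) (by simp [hρ1])
  set m := ∫ x, ρ x
  set c := (∫ x in Set.Ioo 0 ℓ, u x * ρ x) / m with hcdef
  refine ⟨c, ?_⟩
  have hint : IntegrableOn u (Set.Ioo 0 ℓ) := h.1.integrable (by norm_num)
  have key := isOpen_Ioo.ae_eq_zero_of_integral_contDiff_smul_eq_zero (U := Set.Ioo 0 ℓ)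
    (f := fun x => (Set.Ioo 0 ℓ).indicator (fun x => u x - c) x) (μ := volume) ?_ ?_
  · rw [ae_restrict_iff' measurableSet_Ioo]
    filter_upwards [key] with x hx hxm
    have := hx hxm
    rw [Set.indicator_of_mem hxm] at this
    linarith
  · refine IntegrableOn.locallyIntegrableOn ?_
    refine Integrable.integrableOn ?_
    rw [integrable_indicator_iff measurableSet_Ioo]
    exact hint.sub (integrableOn_const (by simp))
  · intro ψ hψ hψc hψs
    set I := ∫ x, ψ x with hI
    -- Subtracting $(I/m)\rho$ makes $\psi$ mean zero, hence the derivative of a test function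
    -- $\varphi$. Testing against $\varphi$ yields $\int u\psi=(I/m)\int u\rho=c\int\psi$.
    have hη : ContDiff ℝ ∞ (fun x => ψ x + -(I / m) * ρ x) :=
      hψ.add (contDiff_const.mul hρ)
    have hρc' : HasCompactSupport (fun x => -(I / m) * ρ x) := hρc.mul_left
    have hηc : HasCompactSupport (fun x => ψ x + -(I / m) * ρ x) := hψc.add hρc'
    have hηs : tsupport (fun x => ψ x + -(I / m) * ρ x) ⊆ Set.Ioo 0 ℓ := by
      refine (tsupport_add _ _).trans (Set.union_subset hψs ?_)
      exact (tsupport_mul_subset_right).trans hρs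
    have hη0 : ∫ x, (ψ x + -(I / m) * ρ x) = 0 := by
      rw [integral_add (hψ.continuous.integrable_of_hasCompactSupport hψc)
        ((hρ.continuous.integrable_of_hasCompactSupport hρc).const_mul _), integral_const_mul]
      change I + -(I / m) * m = 0
      field_simp
      ring
    obtain ⟨φ, hφ, hφc, hφs, hφd⟩ := exists_testFunction_deriv_eq hη hηc hηs hη0
    have h1 := h.2.2 φ hφ hφc hφs
    have iψ := integrable_mul h.1 hψ.continuous hψc
    have iρ := integrable_mul h.1 hρ.continuous hρc
    simp only [hφd, zero_mul, integral_zero, neg_zero] at h1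
    have e1 : ∀ x, u x * (ψ x + -(I / m) * ρ x) = u x * ψ x + -(I / m) * (u x * ρ x) :=
      fun x => by ring
    simp only [e1] at h1
    rw [integral_add iψ (iρ.const_mul _), integral_const_mul] at h1
    have e2 : ∀ x, ψ x • (Set.Ioo 0 ℓ).indicator (fun x => u x - c) x
        = (Set.Ioo 0 ℓ).indicator (fun x => u x * ψ x - c * ψ x) x := by
      intro x
      by_cases hx : x ∈ Set.Ioo 0 ℓ
      · simp only [Set.indicator_of_mem hx, smul_eq_mul]; ring
      · simp only [Set.indicator_of_notMem hx, smul_zero]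
    simp only [e2]
    rw [integral_indicator measurableSet_Ioo, integral_sub iψ
      ((hψ.continuous.integrable_of_hasCompactSupport hψc).integrableOn.const_mul _),
      integral_const_mul, setIntegral_Ioo_eq_integral_of_tsupport_subset hψs, ← hI, hcdef]
    have : (∫ x in Set.Ioo 0 ℓ, u x * ρ x) / m * I = I / m * ∫ x in Set.Ioo 0 ℓ, u x * ρ x := by
      ring
    linarith

/-- A classical derivative is a weak derivative. -/
theorem hasWeakDerivL2_of_hasDerivAt {ℓ : ℝ} (hℓ : 0 < ℓ) {u v : ℝ → ℝ}
    (hd : ∀ x, HasDerivAt u (v x) x) (hv : Continuous v) : HasWeakDerivL2 ℓ u v := by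
  have hu : Continuous u := continuous_iff_continuousAt.2 fun x => (hd x).continuousAt
  have hL : ∀ w : ℝ → ℝ, Continuous w → MemLp w 2 (volume.restrict (Set.Ioo 0 ℓ)) := by
    intro w hw
    obtain ⟨C, hC⟩ := isCompact_Icc.exists_bound_of_continuousOn (hw.continuousOn (s := Set.Icc 0 ℓ))
    refine MemLp.of_bound hw.aestronglyMeasurable C ?_
    filter_upwards [ae_restrict_mem measurableSet_Ioo] with x hx
      using hC x (Set.Ioo_subset_Icc_self hx)
  refine ⟨hL u hu, hL v hv, fun φ hφ hc hs => ?_⟩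
  have hdφ : Continuous (deriv φ) := hφ.continuous_deriv (by simp)
  have h0 : φ 0 = 0 := image_eq_zero_of_notMem_tsupport fun h => lt_irrefl _ (hs h).1
  have h1 : φ ℓ = 0 := image_eq_zero_of_notMem_tsupport fun h => lt_irrefl _ (hs h).2
  have := intervalIntegral.integral_mul_deriv_eq_deriv_mul (a := 0) (b := ℓ) (fun x _ => hd x)
    (fun x _ => ((hφ.differentiable (by simp)) x).hasDerivAt) (hv.intervalIntegrable _ _)
    (hdφ.intervalIntegrable _ _)
  rw [h0, h1, intervalIntegral.integral_of_le hℓ.le, intervalIntegral.integral_of_le hℓ.le,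
    integral_Ioc_eq_integral_Ioo, integral_Ioc_eq_integral_Ioo] at this
  simpa using this

theorem HasWeakDerivL2.congr_ae {ℓ : ℝ} {u v u' v' : ℝ → ℝ} (h : HasWeakDerivL2 ℓ u v)
    (hu : u =ᵐ[volume.restrict (Set.Ioo 0 ℓ)] u') (hv : v =ᵐ[volume.restrict (Set.Ioo 0 ℓ)] v') :
    HasWeakDerivL2 ℓ u' v' := by
  refine ⟨h.1.ae_eq hu, h.2.1.ae_eq hv, fun φ hφ hc hs => ?_⟩
  have h1 : ∫ x in Set.Ioo 0 ℓ, u' x * deriv φ x = ∫ x in Set.Ioo 0 ℓ, u x * deriv φ x :=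
    integral_congr_ae (by filter_upwards [hu] with x hx; rw [hx])
  have h2 : ∫ x in Set.Ioo 0 ℓ, v' x * φ x = ∫ x in Set.Ioo 0 ℓ, v x * φ x :=
    integral_congr_ae (by filter_upwards [hv] with x hx; rw [hx])
  rw [h1, h2, h.2.2 φ hφ hc hs]

/-- A function with a continuous weak derivative agrees almost everywhere with a primitive of it. -/
theorem HasWeakDerivL2.exists_hasDerivAt {ℓ : ℝ} (hℓ : 0 < ℓ) {u v : ℝ → ℝ}
    (h : HasWeakDerivL2 ℓ u v) (hv : Continuous v) :
    ∃ w : ℝ → ℝ, (∀ x, HasDerivAt w (v x) x) ∧ u =ᵐ[volume.restrict (Set.Ioo 0 ℓ)] w := by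
  have hd : ∀ x, HasDerivAt (fun x => ∫ t in (0 : ℝ)..x, v t) (v x) x := fun x =>
    (hv.integral_hasStrictDerivAt 0 x).hasDerivAt
  have h1 := h.add ((hasWeakDerivL2_of_hasDerivAt hℓ hd hv).const_mul (-1))
  simp only [neg_mul, one_mul, add_neg_cancel] at h1
  obtain ⟨c, hc⟩ := h1.ae_eq_const hℓ
  refine ⟨fun x => (∫ t in (0 : ℝ)..x, v t) + c, fun x => (hd x).add_const c, ?_⟩
  filter_upwards [hc] with x hx
  linarith

/-! ### The eigenvalue equation on one edge -/

theorem exists_classical_solution {ℓ μ : ℝ} (hℓ : 0 < ℓ) {u g : ℝ → ℝ} (hu : Continuous u)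
    (h1 : HasWeakDerivL2 ℓ u g) (h2 : HasWeakDerivL2 ℓ g fun x => -(μ * u x)) :
    ∃ w w' : ℝ → ℝ, (∀ x, HasDerivAt w (w' x) x) ∧ (∀ x, HasDerivAt w' (-(μ * u x)) x) ∧
      Set.EqOn u w (Set.Icc 0 ℓ) := by
  obtain ⟨w', hw', he'⟩ := h2.exists_hasDerivAt hℓ (by fun_prop)
  have hc' : Continuous w' := continuous_iff_continuousAt.2 fun x => (hw' x).continuousAt
  obtain ⟨w, hw, he⟩ := (h1.congr_ae Filter.EventuallyEq.rfl he').exists_hasDerivAt hℓ hc'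
  have hc : Continuous w := continuous_iff_continuousAt.2 fun x => (hw x).continuousAt
  refine ⟨w, w', hw, hw', ?_⟩
  refine Measure.eqOn_Icc_of_ae_eq volume hℓ.ne ?_ hu.continuousOn hc.continuousOn
  rwa [← restrict_Ioo_eq_restrict_Icc]

/-- Used below to turn conserved quantities of the equation into identities on the edge. -/
theorem eqOn_const_of_hasDerivAt_zero {ℓ : ℝ} {w w' : ℝ → ℝ}
    (h : ∀ x, HasDerivAt w (w' x) x) (h0 : ∀ x ∈ Set.Icc 0 ℓ, w' x = 0) :
    ∀ x ∈ Set.Icc 0 ℓ, w x = w 0 :=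
  constant_of_has_deriv_right_zero (fun x _ => (h x).continuousAt.continuousWithinAt)
    fun x hx => h0 x ⟨hx.1, hx.2.le⟩ ▸ (h x).hasDerivWithinAt

/-- On the interval $(ww')'=w'^2-\mu w^2\ge 0$, and $ww'$ vanishes at both ends, so $ww'=0$
throughout. Thus $w^2$ is constant, equal to its value $0$ at the left end. -/
theorem eq_zero_of_dirichlet_of_nonpos {ℓ μ : ℝ} (hμ : μ ≤ 0) {u w w' : ℝ → ℝ}
    (hw : ∀ x, HasDerivAt w (w' x) x) (hw' : ∀ x, HasDerivAt w' (-(μ * u x)) x)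
    (he : Set.EqOn u w (Set.Icc 0 ℓ)) (h0 : w 0 = 0) (hl : w ℓ = 0) :
    ∀ x ∈ Set.Icc 0 ℓ, w x = 0 := by
  have hp : ∀ x, HasDerivAt (fun x => w x * w' x) (w' x * w' x + w x * -(μ * u x)) x := fun x =>
    (hw x).mul (hw' x)
  have hmono : MonotoneOn (fun x => w x * w' x) (Set.Icc 0 ℓ) := by
    refine monotoneOn_of_deriv_nonneg (convex_Icc 0 ℓ)
      (fun x _ => (hp x).continuousAt.continuousWithinAt)
      (fun x _ => (hp x).differentiableAt.differentiableWithinAt) fun x hx => ?_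
    rw [(hp x).deriv, he (interior_subset hx)]
    nlinarith [mul_self_nonneg (w' x), mul_nonneg (neg_nonneg.2 hμ) (mul_self_nonneg (w x))]
  have hz : ∀ x ∈ Set.Icc 0 ℓ, w x * w' x = 0 := by
    intro x hx
    have hle : (0 : ℝ) ≤ ℓ := hx.1.trans hx.2
    have h1 := hmono ⟨le_rfl, hle⟩ hx hx.1
    have h2 := hmono hx ⟨hle, le_rfl⟩ hx.2
    simp only [h0, hl, zero_mul] at h1 h2
    exact le_antisymm h2 h1
  have hsq : ∀ x, HasDerivAt (fun x => w x * w x) (w' x * w x + w x * w' x) x := fun x =>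
    (hw x).mul (hw x)
  intro x hx
  have := eqOn_const_of_hasDerivAt_zero hsq (fun x hx => by linarith [hz x hx]) x hx
  simpa [h0] using this

/-- The quantities $w'\cos\kappa x+\kappa w\sin\kappa x$ and $w'\sin\kappa x-\kappa w\cos\kappa x$
are conserved, with values $w'(0)$ and $0$; eliminating $w'$ gives the formula. -/
theorem eq_sin_of_dirichlet_of_pos {ℓ κ : ℝ} (hκ : 0 < κ) {u w w' : ℝ → ℝ}
    (hw : ∀ x, HasDerivAt w (w' x) x) (hw' : ∀ x, HasDerivAt w' (-(κ ^ 2 * u x)) x)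
    (he : Set.EqOn u w (Set.Icc 0 ℓ)) (h0 : w 0 = 0) :
    ∀ x ∈ Set.Icc 0 ℓ, w x = w' 0 / κ * Real.sin (κ * x) := by
  have hs : ∀ x, HasDerivAt (fun x => Real.sin (κ * x)) (Real.cos (κ * x) * κ) x := fun x => by
    simpa using ((hasDerivAt_id x).const_mul κ).sin
  have hc : ∀ x, HasDerivAt (fun x => Real.cos (κ * x)) (-Real.sin (κ * x) * κ) x := fun x => by
    simpa using ((hasDerivAt_id x).const_mul κ).cos
  have h1 := eqOn_const_of_hasDerivAt_zero (ℓ := ℓ)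
    (fun x => ((hw' x).mul (hc x)).add (((hw x).mul (hs x)).const_mul κ))
    (fun x hx => by rw [he hx]; ring)
  have h2 := eqOn_const_of_hasDerivAt_zero (ℓ := ℓ)
    (fun x => ((hw' x).mul (hs x)).sub (((hw x).mul (hc x)).const_mul κ))
    (fun x hx => by rw [he hx]; ring)
  intro x hx
  have e1 := h1 x hx
  have e2 := h2 x hx
  simp [h0] at e1 e2
  have hp := Real.sin_sq_add_cos_sq (κ * x)
  field_simp
  linear_combination Real.sin (κ * x) * e1 - Real.cos (κ * x) * e2 - κ * w x * hp

end MetricGraph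

/-! ### Eigenspaces of the graph -/

namespace MetricGraph

variable {V E : Type*} (Γ : MetricGraph V E)

/-- The `n`-th Dirichlet eigenvalue `(π n / ℓ e)²` of the edge `e`. -/
noncomputable def edgeEigenvalue (p : E × ℕ+) : ℝ := (Real.pi * p.2 / Γ.len p.1) ^ 2

theorem edgeEigenvalue_injective (e : E) : Function.Injective fun n : ℕ+ =>
    Γ.edgeEigenvalue (e, n) := by
  intro n m h
  have hl := Γ.len_pos e
  have h' : Real.pi * n / Γ.len e = Real.pi * m / Γ.len e :=
    (pow_left_inj₀ (by positivity) (by positivity) two_ne_zero).1 h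
  field_simp at h'
  exact PNat.coe_injective (by exact_mod_cast h')

theorem pt_eq_onEdge (f : Γ.Point → ℝ) (e : E) (x : Set.Icc (0 : ℝ) (Γ.len e)) :
    f (Γ.pt ⟨e, x⟩) = Γ.onEdge f e x := by
  rw [onEdge, Set.projIcc_val]

theorem continuous_pt : Continuous Γ.pt := continuous_quot_mk

theorem continuous_onEdge {f : Γ.Point → ℝ} (hf : Continuous f) (e : E) :
    Continuous (Γ.onEdge f e) :=
  hf.comp (Γ.continuous_pt.comp (continuous_sigmaMk.comp continuous_projIcc))

/-- On every edge, a Dirichlet eigenfunction is zero or a multiple of an eigenfunction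
of that edge. -/
theorem IsDirichletSolution.eq_zero_or_eq_sin {μ : ℝ} {f : Γ.Point → ℝ}
    (hf : Γ.IsDirichletSolution μ f) (e : E) :
    (∀ x, f (Γ.pt ⟨e, x⟩) = 0) ∨ ∃ n : ℕ+, Γ.edgeEigenvalue (e, n) = μ ∧
      ∃ c : ℝ, ∀ x, f (Γ.pt ⟨e, x⟩) = c * Real.sin (Real.pi * n / Γ.len e * x) := by
  have hl := Γ.len_pos e
  obtain ⟨hL, hc, hv⟩ := hf
  obtain ⟨g, h1, h2⟩ := hL e
  obtain ⟨w, w', hw, hw', he⟩ :=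
    exists_classical_solution (μ := μ) hl (Γ.continuous_onEdge hc e) h1 h2
  have h0 : w 0 = 0 := by
    have h := hv ⟨e, ⟨0, Set.left_mem_Icc.2 hl.le⟩⟩ (Γ.tail e) (Or.inl ⟨rfl, rfl⟩)
    rwa [Γ.pt_eq_onEdge f, he (Set.left_mem_Icc.2 hl.le)] at h
  have hwl : w (Γ.len e) = 0 := by
    have h := hv ⟨e, ⟨Γ.len e, Set.right_mem_Icc.2 hl.le⟩⟩ (Γ.head e) (Or.inr ⟨rfl, rfl⟩)
    rwa [Γ.pt_eq_onEdge f, he (Set.right_mem_Icc.2 hl.le)] at h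
  rcases le_or_gt μ 0 with hμ | hμ
  · left
    intro x
    rw [Γ.pt_eq_onEdge f, he x.2]
    exact eq_zero_of_dirichlet_of_nonpos hμ hw hw' he h0 hwl x x.2
  obtain ⟨κ, hκ, rfl⟩ : ∃ κ : ℝ, 0 < κ ∧ κ ^ 2 = μ := ⟨√μ, Real.sqrt_pos.2 hμ, Real.sq_sqrt hμ.le⟩
  have hsin := eq_sin_of_dirichlet_of_pos hκ hw hw' he h0
  rcases eq_or_ne (w' 0 / κ) 0 with hz | hz
  · left
    intro x
    rw [Γ.pt_eq_onEdge f, he x.2, hsin x x.2, hz, zero_mul]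
  · right
    have hs := hsin (Γ.len e) ⟨hl.le, le_rfl⟩
    rw [hwl, eq_comm, mul_eq_zero, or_iff_right hz, Real.sin_eq_zero_iff] at hs
    obtain ⟨m, hm⟩ := hs
    have hm0 : 0 < m := by
      have : (0 : ℝ) < m * Real.pi := hm ▸ by positivity
      exact_mod_cast pos_of_mul_pos_left this Real.pi_pos.le
    lift m to ℕ using hm0.le
    have hκe : Real.pi * (m : ℝ) / Γ.len e = κ := by
      rw [div_eq_iff hl.ne', ← hm]; push_cast; ring
    obtain ⟨n, rfl⟩ : ∃ n : ℕ+, (n : ℕ) = m := ⟨⟨m, by exact_mod_cast hm0⟩, rfl⟩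
    refine ⟨n, by simp [edgeEigenvalue, hκe], w' 0 / κ, fun x => ?_⟩
    rw [Γ.pt_eq_onEdge f, he x.2, hsin x x.2, hκe]

/-- This makes edgewise sines compatible with the gluing and gives the vertex condition. -/
theorem sin_eq_zero_of_isEndpointAt (n : E → ℕ+) {p : Γ.EdgePoint} {v : V}
    (h : Γ.IsEndpointAt p v) : Real.sin (Real.pi * n p.1 / Γ.len p.1 * p.2) = 0 := by
  rcases h with ⟨h, -⟩ | ⟨h, -⟩
  · simp [h]
  · rw [h, div_mul_cancel₀ _ (Γ.len_pos _).ne', mul_comm]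
    exact Real.sin_nat_mul_pi _

/-- The function on the graph given by `a e * sin (π n e x / ℓ e)` on the edge `e`. -/
noncomputable def sineFunction (a : E → ℝ) (n : E → ℕ+) : Γ.Point → ℝ :=
  Quot.lift (fun p => a p.1 * Real.sin (Real.pi * n p.1 / Γ.len p.1 * p.2)) <| by
    rintro p q ⟨v, hp, hq⟩
    rw [Γ.sin_eq_zero_of_isEndpointAt n hp, Γ.sin_eq_zero_of_isEndpointAt n hq, mul_zero, mul_zero]

theorem sineFunction_pt (a : E → ℝ) (n : E → ℕ+) (p : Γ.EdgePoint) :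
    Γ.sineFunction a n (Γ.pt p) = a p.1 * Real.sin (Real.pi * n p.1 / Γ.len p.1 * p.2) := rfl

theorem isDirichletSolution_sineFunction {μ : ℝ} {a : E → ℝ} {n : E → ℕ+}
    (h : ∀ e, a e = 0 ∨ Γ.edgeEigenvalue (e, n e) = μ) :
    Γ.IsDirichletSolution μ (Γ.sineFunction a n) := by
  refine ⟨fun e => ?_, continuous_quot_lift _ ?_, fun p v hp => ?_⟩
  · set κ := Real.pi * n e / Γ.len e with hκ
    have hu : ∀ x, HasDerivAt (fun x => a e * Real.sin (κ * x)) (a e * κ * Real.cos (κ * x)) x :=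
      fun x => by simpa [mul_comm, mul_left_comm, mul_assoc] using
        (((hasDerivAt_id x).const_mul κ).sin).const_mul (a e)
    have hμ : a e * κ * κ = μ * a e := by
      rcases h e with h | h
      · simp [h]
      · rw [← h, edgeEigenvalue, ← hκ]; ring
    have hv : ∀ x, HasDerivAt (fun x => a e * κ * Real.cos (κ * x))
        (-(μ * (a e * Real.sin (κ * x)))) x := fun x => by
      rw [← mul_assoc, ← hμ]
      simpa [mul_comm, mul_left_comm, mul_assoc] using
        (((hasDerivAt_id x).const_mul κ).cos).const_mul (a e * κ)
    have he : (fun x => a e * Real.sin (κ * x)) =ᵐ[volume.restrict (Set.Ioo 0 (Γ.len e))]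
        Γ.onEdge (Γ.sineFunction a n) e := by
      filter_upwards [ae_restrict_mem measurableSet_Ioo] with x hx
      rw [onEdge, sineFunction_pt, Set.projIcc_of_mem _ (Set.Ioo_subset_Icc_self hx)]
    refine ⟨_, (hasWeakDerivL2_of_hasDerivAt (Γ.len_pos e) hu (by fun_prop)).congr_ae he
      Filter.EventuallyEq.rfl, (hasWeakDerivL2_of_hasDerivAt (Γ.len_pos e) hv (by fun_prop)).congr_ae
      Filter.EventuallyEq.rfl ?_⟩
    filter_upwards [he] with x hx
    change -(μ * (a e * Real.sin (κ * x))) = -(μ * Γ.onEdge (Γ.sineFunction a n) e x)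
    rw [← hx]
  · refine continuous_sigma fun e => ?_
    change Continuous fun x : Set.Icc (0 : ℝ) (Γ.len e) =>
      a e * Real.sin (Real.pi * n e / Γ.len e * x)
    generalize Real.pi * n e / Γ.len e = κ
    fun_prop
  · rw [sineFunction_pt, Γ.sin_eq_zero_of_isEndpointAt n hp, mul_zero]

/-- The edges of which `μ` is a Dirichlet eigenvalue. -/
abbrev ResonantEdge (μ : ℝ) : Type _ := {e : E // ∃ n, Γ.edgeEigenvalue (e, n) = μ}

/-- A point of a resonant edge at which the eigenfunction of the edge is maximal. -/
noncomputable def peak {μ : ℝ} (e : Γ.ResonantEdge μ) : Γ.EdgePoint :=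
  ⟨e.1, Γ.len e / (2 * e.2.choose), by have := Γ.len_pos e; positivity, by
    have h : (1 : ℝ) ≤ e.2.choose := by exact_mod_cast e.2.choose.2
    exact div_le_self (Γ.len_pos e).le (by linarith)⟩

theorem sin_peak {μ : ℝ} (e : Γ.ResonantEdge μ) {n : ℕ+} (hn : Γ.edgeEigenvalue (e.1, n) = μ) :
    Real.sin (Real.pi * n / Γ.len e * (Γ.peak e).2) = 1 := by
  have hl := Γ.len_pos e
  have : e.2.choose = n := Γ.edgeEigenvalue_injective e (e.2.choose_spec.trans hn.symm)
  have hn : (0 : ℝ) < n := by exact_mod_cast n.2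
  change Real.sin (Real.pi * n / Γ.len e * (Γ.len e / (2 * e.2.choose))) = 1
  rw [this, ← Real.sin_pi_div_two]
  congr 1
  field_simp

/-- Evaluation of a Dirichlet eigenfunction at the peaks of the resonant edges. -/
noncomputable def evalPeaks (μ : ℝ) : Γ.dirichletEigenspace μ →ₗ[ℝ] (Γ.ResonantEdge μ → ℝ) where
  toFun f e := f.1 (Γ.pt (Γ.peak e))
  map_add' _ _ := rfl
  map_smul' _ _ := rfl

/-- On a resonant edge $\mu$ determines $n$, leaving one free amplitude, and the sine equals $1$ at
the peak, so evaluation there reads off the amplitude. On all other edges eigenfunctions vanish. -/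
theorem evalPeaks_bijective (μ : ℝ) : Function.Bijective (Γ.evalPeaks μ) := by
  constructor
  · rw [← LinearMap.ker_eq_bot, LinearMap.ker_eq_bot']
    rintro ⟨f, hf⟩ h
    ext q
    obtain ⟨⟨e, x⟩, rfl⟩ := Quot.exists_rep q
    rcases IsDirichletSolution.eq_zero_or_eq_sin Γ hf e with h0 | ⟨n, hn, c, hc⟩
    · exact h0 x
    · have h1 := congrFun h ⟨e, n, hn⟩
      have h2 : c * Real.sin (Real.pi * n / Γ.len e * (Γ.peak (μ := μ) ⟨e, n, hn⟩).2) = 0 :=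
        (hc _).symm.trans h1
      rw [Γ.sin_peak ⟨e, n, hn⟩ hn, mul_one] at h2
      exact (hc x).trans (by rw [h2, zero_mul]; rfl)
  · intro c
    classical
    let a : E → ℝ := fun e => if h : ∃ n, Γ.edgeEigenvalue (e, n) = μ then c ⟨e, h⟩ else 0
    -- The default `1` is immaterial: the amplitude `a e` is zero on such edges.
    let n : E → ℕ+ := fun e => if h : ∃ n, Γ.edgeEigenvalue (e, n) = μ then h.choose else 1
    have hn : ∀ e : Γ.ResonantEdge μ, Γ.edgeEigenvalue (e.1, n e.1) = μ := fun e => by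
      simp only [n, dif_pos e.2]; exact e.2.choose_spec
    refine ⟨⟨Γ.sineFunction a n, Γ.isDirichletSolution_sineFunction fun e => ?_⟩, ?_⟩
    · by_cases h : ∃ n, Γ.edgeEigenvalue (e, n) = μ
      · exact Or.inr (hn ⟨e, h⟩)
      · exact Or.inl (dif_neg h)
    · ext e
      change a e.1 * Real.sin (Real.pi * n e.1 / Γ.len e * (Γ.peak e).2) = c e
      rw [Γ.sin_peak e (hn e), mul_one]
      exact dif_pos e.2

theorem finiteDimensional_dirichletEigenspace [Finite E] (μ : ℝ) :
    FiniteDimensional ℝ (Γ.dirichletEigenspace μ) :=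
  (LinearEquiv.ofBijective _ (Γ.evalPeaks_bijective μ)).symm.finiteDimensional

/-- The multiplicity of `μ` is the number of pairs `(e, n)` with `(π n / ℓ e)² = μ`. -/
theorem finrank_dirichletEigenspace [Finite E] (μ : ℝ) :
    Module.finrank ℝ (Γ.dirichletEigenspace μ) = {p | Γ.edgeEigenvalue p = μ}.ncard := by
  have := Fintype.ofFinite (Γ.ResonantEdge μ)
  rw [(LinearEquiv.ofBijective _ (Γ.evalPeaks_bijective μ)).finrank_eq, Module.finrank_pi,
    ← Nat.card_eq_fintype_card, ← Nat.card_coe_set_eq]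
  refine Nat.card_congr (Equiv.ofBijective
    (fun e => (⟨(e.1, e.2.choose), e.2.choose_spec⟩ : {p | Γ.edgeEigenvalue p = μ})) ⟨?_, ?_⟩)
  · intro e e' h
    exact Subtype.ext (congrArg (fun p => p.1.1) h)
  · rintro ⟨⟨e, n⟩, hn⟩
    have h : ∃ n, Γ.edgeEigenvalue (e, n) = μ := ⟨n, hn⟩
    refine ⟨⟨e, h⟩, Subtype.ext (Prod.ext rfl ?_)⟩
    exact Γ.edgeEigenvalue_injective e (h.choose_spec.trans hn.symm)

end MetricGraph

/-! ### Enumerating and matching families -/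

/-- An infinite countable family of real numbers with finite sublevel sets can be enumerated
in increasing order. -/
theorem exists_equiv_monotone_comp {P : Type*} [Countable P] [Infinite P] (val : P → ℝ)
    (hfin : ∀ b, {p | val p ≤ b}.Finite) : ∃ σ : ℕ+ ≃ P, Monotone (val ∘ σ) := by
  obtain ⟨enc, henc⟩ := exists_injective_nat P
  -- Ties between equal values are broken by the injection into `ℕ`, so that the rank `r`, the
  -- number of strictly smaller keys, is injective.
  let key : P → ℝ ×ₗ ℕ := fun p => toLex (val p, enc p)
  have hkey : Function.Injective key := fun p q h => henc (congrArg (fun z => (ofLex z).2) h)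
  have hval : ∀ p q, key p ≤ key q → val p ≤ val q := fun p q h => by
    rcases Prod.Lex.le_iff.1 h with h | h
    · exact h.le
    · exact h.1.le
  have hf : ∀ p, {q | key q < key p}.Finite := fun p =>
    (hfin (val p)).subset fun q hq => hval q p (le_of_lt hq)
  let r : P → ℕ := fun p => {q | key q < key p}.ncard
  have hr : ∀ p q, key p < key q → r p < r q := fun p q h =>
    Set.ncard_lt_ncard ⟨fun _ hz => lt_trans hz h, fun hs => lt_irrefl (key p) (hs h)⟩ (hf q)
  have hinj : Function.Injective r := fun p q h => by
    rcases lt_trichotomy (key p) (key q) with h' | h' | h'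
    · exact absurd h (hr p q h').ne
    · exact hkey h'
    · exact absurd h (hr q p h').ne'
  have hrle : ∀ p q, r p ≤ r q → val p ≤ val q := fun p q h =>
    hval p q (not_lt.1 fun h' => absurd h (not_le.2 (hr q p h')))
  have : Infinite (Set.range r) := (Set.infinite_range_of_injective hinj).to_subtype
  classical
  let o : ℕ ≃o Set.range r := Nat.Subtype.orderIsoOfNat (Set.range r)
  refine ⟨(Equiv.pnatEquivNat.trans o.toEquiv).trans (Equiv.ofInjective r hinj).symm,
    fun i j hij => hrle _ _ ?_⟩
  have hs : ∀ z : Set.range r, r ((Equiv.ofInjective r hinj).symm z) = z := fun z =>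
    Equiv.apply_ofInjective_symm hinj z
  simp only [Equiv.trans_apply, hs]
  have : o (Equiv.pnatEquivNat i) ≤ o (Equiv.pnatEquivNat j) :=
    o.monotone (Nat.pred_le_pred hij)
  exact this

/-- Two families whose fibers are finite of the same size agree up to a bijection. -/
theorem exists_equiv_comp_eq_of_ncard_fiber_eq {P Q R : Type*} {f : P → R} {g : Q → R}
    (hf : ∀ y, {p | f p = y}.Finite) (hg : ∀ y, {q | g q = y}.Finite)
    (h : ∀ y, {p | f p = y}.ncard = {q | g q = y}.ncard) : ∃ σ : P ≃ Q, ∀ p, g (σ p) = f p := by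
  have e : ∀ y, Nonempty ({p // f p = y} ≃ {q // g q = y}) := fun y => by
    -- Finiteness is essential: `ncard` is $0$ on infinite sets.
    have : Finite {p // f p = y} := hf y
    have : Finite {q // g q = y} := hg y
    exact Finite.card_eq.1 (((Nat.card_coe_set_eq _).trans (h y)).trans (Nat.card_coe_set_eq _).symm)
  refine ⟨(Equiv.sigmaFiberEquiv f).symm.trans
    ((Equiv.sigmaCongrRight fun y => (e y).some).trans (Equiv.sigmaFiberEquiv g)), fun p => ?_⟩
  exact ((e (f p)).some ⟨p, rfl⟩).2

/-! ### Counting eigenvalues -/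

namespace MetricGraph

variable {V E : Type*} (Γ : MetricGraph V E)

theorem edgeEigenvalue_le_sq_iff {κ : ℝ} (hκ : 0 ≤ κ) (p : E × ℕ+) :
    Γ.edgeEigenvalue p ≤ (Real.pi * κ) ^ 2 ↔ (p.2 : ℕ) ≤ ⌊Γ.len p.1 * κ⌋₊ := by
  have hl := Γ.len_pos p.1
  rw [edgeEigenvalue, pow_le_pow_iff_left₀ (by positivity) (by positivity) two_ne_zero,
    Nat.le_floor_iff (by positivity), div_le_iff₀ hl, mul_assoc, mul_le_mul_iff_right₀ Real.pi_pos,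
    mul_comm κ]

theorem finite_edgeEigenvalue_le [Finite E] (b : ℝ) : {p | Γ.edgeEigenvalue p ≤ b}.Finite := by
  -- Chosen so that $(\pi\kappa)^2=\max(b,0)$.
  set κ := √(max b 0) / Real.pi with hκ
  have hκ0 : 0 ≤ κ := by positivity
  have hb : b ≤ (Real.pi * κ) ^ 2 := by
    rw [hκ, mul_div_cancel₀ _ Real.pi_ne_zero, Real.sq_sqrt (le_max_right _ _)]
    exact le_max_left _ _
  have hfin : (⋃ e : E, (fun n => (e, n)) '' {n : ℕ+ | (n : ℕ) ≤ ⌊Γ.len e * κ⌋₊}).Finite := by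
    refine Set.finite_iUnion fun e => Set.Finite.image _ ?_
    exact (Set.finite_le_nat _).preimage PNat.coe_injective.injOn
  refine hfin.subset fun p hp => Set.mem_iUnion.2 ⟨p.1, p.2, ?_, rfl⟩
  exact (Γ.edgeEigenvalue_le_sq_iff hκ0 p).1 (le_trans hp hb)

/-- At least `k` of the numbers `(π n / ℓ e)²` lie below the bound. -/
theorem le_ncard_edgeEigenvalue_le [Fintype E] [Nonempty E] (k : ℕ+) :
    (k : ℕ) ≤ {p | Γ.edgeEigenvalue p ≤
      (Real.pi * (((k : ℝ) - 1 + Fintype.card E) / Γ.totalLength)) ^ 2}.ncard := by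
  have hL : 0 < Γ.totalLength :=
    Finset.sum_pos (fun e _ => Γ.len_pos e) Finset.univ_nonempty
  have hk : (1 : ℝ) ≤ k := by exact_mod_cast k.2
  set κ := ((k : ℝ) - 1 + Fintype.card E) / Γ.totalLength with hκ
  have hκ0 : 0 ≤ κ := div_nonneg (by have := Nat.cast_nonneg (α := ℝ) (Fintype.card E); linarith)
    hL.le
  -- The shift by `succPNat` sends the indices $0,\dots,\lfloor\ell_e\kappa\rfloor-1$ to
  -- $n=1,\dots,\lfloor\ell_e\kappa\rfloor$.
  let F : (Σ e : E, Fin ⌊Γ.len e * κ⌋₊) → {p | Γ.edgeEigenvalue p ≤ (Real.pi * κ) ^ 2} :=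
    fun z => ⟨(z.1, z.2.1.succPNat), (Γ.edgeEigenvalue_le_sq_iff hκ0 _).2 z.2.2⟩
  have hF : Function.Injective F := by
    rintro ⟨e, i⟩ ⟨e', j⟩ h
    have h1 : e = e' := congrArg (fun z => z.1.1) h
    have h2 : i.1 = j.1 := Nat.succPNat_injective (congrArg (fun z => z.1.2) h)
    clear h
    subst h1
    rw [Fin.ext h2]
  have := (Γ.finite_edgeEigenvalue_le ((Real.pi * κ) ^ 2)).to_subtype
  have hcard := Nat.card_le_card_of_injective F hF
  rw [Nat.card_coe_set_eq] at hcard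
  refine le_trans ?_ hcard
  rw [Nat.card_eq_fintype_card, Fintype.card_sigma]
  simp only [Fintype.card_fin]
  -- Each floor loses strictly less than $1$. With $N$ the sum of the floors,
  -- $k-1+|E|=L\kappa<N+|E|$, and integrality upgrades $k<N+1$ to $k\le N$.
  have hsum : ∑ e, Γ.len e * κ < ∑ e, ((⌊Γ.len e * κ⌋₊ : ℝ) + 1) :=
    Finset.sum_lt_sum_of_nonempty Finset.univ_nonempty fun e _ => Nat.lt_floor_add_one _
  rw [← Finset.sum_mul, ← totalLength, hκ, mul_div_cancel₀ _ hL.ne', Finset.sum_add_distrib,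
    ← Nat.cast_sum] at hsum
  simp only [Finset.sum_const, Finset.card_univ, nsmul_eq_mul, mul_one] at hsum
  have h3 : (k : ℝ) < ((∑ e, ⌊Γ.len e * κ⌋₊ : ℕ) : ℝ) + 1 := by linarith
  exact Nat.lt_succ_iff.1 (by exact_mod_cast h3)

theorem exists_isDirichletEigenvalueSequence [Finite E] [Nonempty E] :
    ∃ lam : ℕ+ → ℝ, Γ.IsDirichletEigenvalueSequence lam := by
  obtain ⟨σ, hσ⟩ := exists_equiv_monotone_comp Γ.edgeEigenvalue Γ.finite_edgeEigenvalue_le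
  refine ⟨_, hσ, ?_, Γ.finiteDimensional_dirichletEigenspace, fun μ => ?_⟩
  · refine Filter.tendsto_atTop_atTop_of_monotone hσ fun b => ?_
    by_contra! h
    have hfin : (σ ⁻¹' {p | Γ.edgeEigenvalue p ≤ b}).Finite :=
      (Γ.finite_edgeEigenvalue_le b).preimage σ.injective.injOn
    exact Set.infinite_univ (hfin.subset fun k _ => (h k).le)
  · rw [finrank_dirichletEigenspace, ← Nat.card_coe_set_eq, ← Nat.card_coe_set_eq]
    exact Nat.card_congr (σ.subtypeEquiv fun _ => Iff.rfl)

theorem IsDirichletEigenvalueSequence.finite_le {Γ : MetricGraph V E} {lam : ℕ+ → ℝ}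
    (h : Γ.IsDirichletEigenvalueSequence lam) (b : ℝ) : {k | lam k ≤ b}.Finite := by
  obtain ⟨N, hN⟩ := (h.tendsto.eventually_gt_atTop b).exists_forall_of_atTop
  exact (Set.finite_Iio N).subset fun k hk => not_le.1 fun hle => absurd hk (not_le.2 (hN k hle))

/-- Equal multiplicities make any eigenvalue sequence a rearrangement of the edge eigenvalues, so
both have equally many terms up to $b$. If $b<\lambda_k$, monotonicity allows only indices below
$k$, at most $k-1$ of them. -/
theorem IsDirichletEigenvalueSequence.le_of_le_ncard [Finite E] {Γ : MetricGraph V E}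
    {lam : ℕ+ → ℝ} (h : Γ.IsDirichletEigenvalueSequence lam) {b : ℝ} {k : ℕ+}
    (hk : (k : ℕ) ≤ {p | Γ.edgeEigenvalue p ≤ b}.ncard) : lam k ≤ b := by
  obtain ⟨σ, hσ⟩ := exists_equiv_comp_eq_of_ncard_fiber_eq (f := Γ.edgeEigenvalue) (g := lam)
    (fun y => (Γ.finite_edgeEigenvalue_le y).subset fun _ hp => le_of_eq hp)
    (fun y => (h.finite_le y).subset fun _ hp => le_of_eq hp)
    fun y => by rw [h.ncard_eq, finrank_dirichletEigenspace]
  have hcard : {p | Γ.edgeEigenvalue p ≤ b}.ncard = {j | lam j ≤ b}.ncard := by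
    rw [← Nat.card_coe_set_eq, ← Nat.card_coe_set_eq]
    exact Nat.card_congr (σ.subtypeEquiv fun p => by simp [hσ])
  by_contra! hlt
  have hsub : {j | lam j ≤ b} ⊆ (Finset.Iio k : Finset ℕ+) := fun j hj =>
    Finset.mem_coe.2 (Finset.mem_Iio.2 (not_le.1 fun hle =>
      absurd (hlt.trans_le (h.monotone hle)) (not_lt.2 hj)))
  have h1 := Set.ncard_le_ncard hsub (Finset.finite_toSet _)
  rw [Set.ncard_coe_finset] at h1
  have h2 : (Finset.Iio k).card = (k : ℕ) - 1 := by
    rw [← Finset.Ico_bot, PNat.card_Ico, PNat.bot_eq_one, PNat.one_coe]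
  have := k.pos
  omega

end MetricGraph

theorem mainTheorem5 {V E : Type*} [Finite V] [Fintype E] [Nonempty E] (Γ : MetricGraph V E) :
    (∃ lam : ℕ+ → ℝ, Γ.IsDirichletEigenvalueSequence lam) ∧
    ∀ lam : ℕ+ → ℝ, Γ.IsDirichletEigenvalueSequence lam →
      ∀ k : ℕ+, lam k ≤
        Real.pi ^ 2 / Γ.totalLength ^ 2 * ((k : ℝ) - 1 + (Fintype.card E : ℝ)) ^ 2 := by
  refine ⟨Γ.exists_isDirichletEigenvalueSequence, fun lam h k => ?_⟩
  have := h.le_of_le_ncard (Γ.le_ncard_edgeEigenvalue_le k)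
  rwa [mul_pow, div_pow, mul_div_assoc', mul_div_right_comm] at this
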